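/- **Setting.** Let $N$ be the number of agents and $K\ge 1$ an integer. Let $\mathbb X$ be a standard Borel space, let $\mathbb Y=\prod_{i=1}^N\mathbb Y^i$ and $\mathbb U=\prod_{i=1}^N\mathbb U^i$, let $\mathcal T(dx'\mid x,\mathbf u)$ be a transition kernel from $\mathbb X\times\mathbb U$ to $\mathbb X$, and let $Q^i(dy\mid x)$ be measurement kernels from $\mathbb X$ to $\mathbb Y^i$. Given the state $x_t$ the agents' measurements $y^i_t\sim Q^i(\cdot\mid x_t)$ are independent, and $x_{t+1}\sim\mathcal T(\cdot\mid x_t,\mathbf u_t)$. Write $Q(\mathbf y\mid x)=\prod_i Q^i(\{y^i\}\mid x)$. Information is shared every $K$ steps: at time $t=sK+r$, $0\le r<K$, agent $i$ chooses $u^i_t$ as a function of all agents' measurements and actions before time $sK$ and of its own measurements at times $sK,\dots,sK+r$ and own actions at times $sK,\dots,sK+r-1$. A family $\gamma$ of such (deterministic) functions is an admissible policy. For a probability measure $Z$ on $\mathbb X$ and $(\mathbf y,\mathbf u)\in\mathbb Y\times\mathbb U$ the Bayesian predictor update is $$F(Z,\mathbf u,\mathbf y)(A)=\frac{\int \mathcal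 T(A\mid x,\mathbf u)\,Q(\mathbf y\mid x)\,Z(dx)}{\int Q(\mathbf y\mid x)\,Z(dx)} .$$ For a window length $M$, start the system at time $-MK$ with $x_{-MK}\sim\pi$ (so that a window of $M$ periods is already available at time $0$). For $q\ge 0$ let $\pi_{q-M}$ be the predictor at time $(q-M)K$, i.e. the conditional law of $x_{(q-M)K}$ given all measurements and actions at the times $-MK,\dots,(q-M)K-1$, and for a probability measure $\rho$ on $\mathbb X$ let $\pi_q(\rho,\mathbf y_{[(q-M)K,qK-1]},\mathbf u_{[(q-M)K,qK-1]})$ be the measure obtained from $\rho$ by applying $F$ successively along the measurements and actions at the times $(q-M)K,\dots,qK-1$. With $\|\mu-\nu\|_{TV}=2\sup_B|\mu(B)-\nu(B)|$, put $$L_q(M)=\sup_\gamma E^\gamma_\pi\Big[\big\|\pi_q(\pi_{q-M},\mathbf y_{[(q-M)K,qK-1]},\mathbf u_{[(q-M)K,qK-1]})-\pi_q(\pi^*,\mathbf y_{[(q-M)K,qK-1]},\mathbf u_{[(q-M)K,qK-1]})\big\|_{TV}\Big],$$ the supremum being over all admissible policies (which include those induced by stationary Markov policies of the equivalent sliding-window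 decision process, whose state is $\pi_{q-M}$ together with the window). **Theorem.** Assume that 1. all $\mathbb Y^i$ and $\mathbb U^i$ are finite; 2. there is $\epsilon>0$ with $Q(\mathbf y\mid x)\ge\epsilon$ for all $x\in\mathbb X$, $\mathbf y\in\mathbb Y$; 3. there are a nonnegative measure $\lambda$ on $\mathbb X$ and constants $\epsilon_{\mathbf u}>0$ ($\mathbf u\in\mathbb U$) with $$\epsilon_{\mathbf u}\,\lambda(A)\le\mathcal T(A\mid x,\mathbf u)\le\frac1{\epsilon_{\mathbf u}}\,\lambda(A)\qquad\text{for all Borel }A\subseteq\mathbb X,\ x\in\mathbb X,\ \mathbf u\in\mathbb U .$$ Then for all probability measures $\pi,\pi^*$ on $\mathbb X$ and every $q\ge 0$, $L_q(M)\to 0$ as $M\to\infty$. -/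

import Mathlib

open MeasureTheory ProbabilityTheory Filter Topology
open scoped ENNReal

namespace DecentralizedControl

/-- The total variation distance `‖μ - ν‖_TV = 2 sup_B |μ(B) - ν(B)|`, over measurable sets `B`. -/
noncomputable def tvDist {X : Type*} [MeasurableSpace X] (μ ν : Measure X) : ℝ≥0∞ :=
  2 * ⨆ (B : Set X) (_ : MeasurableSet B), ENNReal.ofReal |μ.real B - ν.real B|

section Model

variable {N : ℕ} {X : Type*} {Y U : Fin N → Type*}

/-- Joint measurements and joint actions of all agents over `n` consecutive time steps. -/
abbrev Record (Y U : Fin N → Type*) (n : ℕ) : Type _ :=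
  Fin n → (∀ i, Y i) × (∀ i, U i)

/-- Admissible team policies under the `K`-step periodic information sharing pattern. At time
`t = q K + r` with `q = t / K` and `r = t % K`, agent `i` chooses its action from the common
information (all measurements and actions at the times `0, …, q K - 1`) and from its private
information (its own measurements at the times `q K, …, q K + r` and its own actions at the times
`q K, …, q K + r - 1`). -/
abbrev Policy (Y U : Fin N → Type*) (K : ℕ) : Type _ :=
  ∀ (i : Fin N) (t : ℕ), Record Y U (K * (t / K)) →
    (Fin (t % K + 1) → Y i) → (Fin (t % K) → U i) → U i

/-- The joint action applied at time `t` under `γ` when the record of the times `0, …, t - 1` is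
`h` and the joint measurement at time `t` is `y`. -/
def Policy.act {K : ℕ} (γ : Policy Y U K) (t : ℕ) (h : Record Y U t) (y : ∀ i, Y i) :
    ∀ i, U i := fun i =>
  γ i t (fun j => h ⟨j, j.2.trans_le (Nat.mul_div_le t K)⟩)
    (Fin.snoc (α := fun _ => Y i)
      (fun j : Fin (t % K) =>
        (h ⟨K * (t / K) + j,
          (Nat.add_lt_add_left j.2 _).trans_eq (Nat.div_add_mod t K)⟩).1 i) (y i))
    (fun j : Fin (t % K) =>
      (h ⟨K * (t / K) + j,
        (Nat.add_lt_add_left j.2 _).trans_eq (Nat.div_add_mod t K)⟩).2 i)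

variable [MeasurableSpace X] [∀ i, MeasurableSpace (Y i)] [∀ i, MeasurableSpace (U i)]

/-- The likelihood `Q(y | x) = ∏ i, Q^i(y^i | x)` of the joint measurement `y` in state `x`. -/
noncomputable def likelihood (Q : ∀ i, Kernel X (Y i)) (y : ∀ i, Y i) (x : X) : ℝ≥0∞ :=
  ∏ i, Q i x {y i}

section Law

variable [∀ i, Finite (Y i)] [∀ i, MeasurableSingletonClass (Y i)]
  [∀ i, Finite (U i)] [∀ i, MeasurableSingletonClass (U i)]

/-- The joint measurement channel: given the state, the agents' measurements are independent. -/
noncomputable def obsKernel (Q : ∀ i, Kernel X (Y i)) [∀ i, IsMarkovKernel (Q i)] :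
    Kernel X (∀ i, Y i) where
  toFun x := Measure.pi fun i => Q i x
  measurable' := by
    classical
    have := fun i => Fintype.ofFinite (Y i)
    refine Measure.measurable_of_measurable_coe _ fun s _ => ?_
    have key : ∀ x, (Measure.pi fun i => Q i x) s
        = ∑ y ∈ s.toFinite.toFinset, ∏ i, Q i x {y i} := by
      intro x
      rw [← s.toFinite.coe_toFinset, ← sum_measure_singleton]
      simp [Measure.pi_singleton]
    simp_rw [key]
    exact Finset.measurable_sum _ fun y _ => Finset.measurable_prod _ fun i _ =>
      (Q i).measurable_coe (measurableSet_singleton _)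

theorem measurable_act {K : ℕ} (γ : Policy Y U K) (t : ℕ) :
    Measurable fun z : (X × Record Y U t) × (∀ i, Y i) =>
      ((z.1.1, γ.act t z.1.2 z.2) : X × (∀ i, U i)) :=
  (measurable_fst.comp measurable_fst).prodMk
    ((measurable_of_finite fun p : Record Y U t × (∀ i, Y i) => γ.act t p.1 p.2).comp
      ((measurable_snd.comp measurable_fst).prodMk measurable_snd))

/-- The joint law, under the policy `γ` and with `x_0 ∼ π`, of the state `x_t` and of the record of
all measurements and actions at the times `0, …, t - 1`. From `(x_t, h)` one draws
`y_t ∼ Q(· | x_t)`, applies `u_t = γ_t(h, y_t)` and draws `x_{t+1} ∼ T(· | x_t, u_t)`. -/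
noncomputable def law {K : ℕ} (T : Kernel (X × (∀ i, U i)) X) (Q : ∀ i, Kernel X (Y i))
    [∀ i, IsMarkovKernel (Q i)] (π : Measure X) (γ : Policy Y U K) :
    (t : ℕ) → Measure (X × Record Y U t)
  | 0 => π.map fun x => (x, Fin.elim0)
  | t + 1 =>
    ((law T Q π γ t) ⊗ₘ
      (((obsKernel Q).comap Prod.fst measurable_fst) ⊗ₖ
        (T.comap (fun z : (X × Record Y U t) × (∀ i, Y i) => (z.1.1, γ.act t z.1.2 z.2))
          (measurable_act γ t)))).map
      fun z => (z.2.2, Fin.snoc (α := fun _ => (∀ i, Y i) × (∀ i, U i)) z.1.2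
        (z.2.1, γ.act t z.1.2 z.2.1))

/-- The predictor `P(x_t ∈ · | y_{[0,t-1]}, u_{[0,t-1]})`, evaluated at the record `h`. -/
noncomputable def predictor {K : ℕ} (T : Kernel (X × (∀ i, U i)) X) (Q : ∀ i, Kernel X (Y i))
    [∀ i, IsMarkovKernel (Q i)] (π : Measure X) (γ : Policy Y U K) (t : ℕ) (h : Record Y U t) :
    Measure X :=
  (cond (law T Q π γ t) (Prod.snd ⁻¹' {h})).map Prod.fst

end Law

/-- One Bayesian update of the predictor `Z`, after the joint measurement `y` and joint action `u`:
`A ↦ ∫ T(A | x, u) Q(y | x) Z(dx) / ∫ Q(y | x) Z(dx)`. -/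
noncomputable def bayesUpdate (T : Kernel (X × (∀ i, U i)) X) (Q : ∀ i, Kernel X (Y i))
    (Z : Measure X) (y : ∀ i, Y i) (u : ∀ i, U i) : Measure X :=
  ((∫⁻ x, likelihood Q y x ∂Z)⁻¹ • Z.withDensity (likelihood Q y)).bind fun x => T (x, u)

/-- The predictor obtained from `Z` by successive Bayesian updates along the record `w`. -/
noncomputable def updateAlong (T : Kernel (X × (∀ i, U i)) X) (Q : ∀ i, Kernel X (Y i))
    (Z : Measure X) : {n : ℕ} → Record Y U n → Measure X
  | 0, _ => Z
  | n + 1, w =>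
    bayesUpdate T Q (updateAlong T Q Z (n := n) fun j => w j.castSucc)
      (w (Fin.last n)).1 (w (Fin.last n)).2

/-- The quantity
`L_q = sup_γ E_π^γ ‖π_q(π_{q-M}, y_{[(q-M)K,qK-1]}, u_{[(q-M)K,qK-1]})
  - π_q(π*, y_{[(q-M)K,qK-1]}, u_{[(q-M)K,qK-1]})‖_TV`
for the window length `M` (in stages of `K` time steps).

The window is available already at stage `0`, so the system starts at stage `-M`, with
`x_{-MK} ∼ π`. Here time is counted from that start: stage `q - M` begins at time `q * K`,
and stage `q` begins at time `(q + M) * K`. -/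
noncomputable def predictorError [∀ i, Finite (Y i)] [∀ i, MeasurableSingletonClass (Y i)]
    [∀ i, Finite (U i)] [∀ i, MeasurableSingletonClass (U i)] (K : ℕ)
    (T : Kernel (X × (∀ i, U i)) X) (Q : ∀ i, Kernel X (Y i)) [∀ i, IsMarkovKernel (Q i)]
    (π πstar : Measure X) (q M : ℕ) : ℝ≥0∞ :=
  ⨆ γ : Policy Y U K, ∫⁻ z,
    (let past : Record Y U (q * K) := fun j =>
        z.2 ⟨j, j.2.trans_le (Nat.mul_le_mul_right K (Nat.le_add_right q M))⟩
     let window : Record Y U (M * K) := fun j =>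
        z.2 ⟨q * K + j, (Nat.add_lt_add_left j.2 _).trans_eq (Nat.add_mul q M K).symm⟩
     tvDist (updateAlong T Q (predictor T Q π γ (q * K) past) window)
       (updateAlong T Q πstar window))
    ∂(law T Q π γ ((q + M) * K))

end Model

end DecentralizedControl

/-!
Along any fixed record, the filter that iterates `bayesUpdate` forgets its prior at a geometric rate
that depends neither on the record nor on the prior, and this bounds the predictor error uniformly
in the policy.

The distance in which the filter contracts is a form of Hilbert's projective metric: `Comparable μ
ν r` says that `m ν ≤ μ ≤ m (1 + r) ν` for some `m > 0`. It ignores the normalization in Bayes'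
rule, and for probability measures it bounds the total variation distance by `2 r`
(`Comparable.tvDist_le`). If all `T (x, u)` lie between `ε λ` and `ε⁻¹ λ`, then one update makes any
two priors comparable with `r = ε⁻⁴ - 1` (`comparable_bayesUpdate`), and every further update
multiplies `r` by `1 - ε ^ 2` (`Comparable.update`). The likelihood need only be positive
everywhere, so that Bayes' rule never divides by zero.

The window contains `M K ≥ M` updates. One of the two priors is the predictor at the start of the
window, which is a probability measure only on records of positive probability; almost every record
is of this kind (`ae_law_preimage_ne_zero`).
-/

namespace DecentralizedControl

/-! ### Projective comparison of measures -/

/-- `μ` is comparable with `ν` with slack `r`: for some `m > 0`, `m ν ≤ μ ≤ m (1 + r) ν`. The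
constant `m` is left free, so that the notion does not depend on how the measures are normalized. -/
def Comparable {X : Type*} [MeasurableSpace X] (μ ν : Measure X) (r : ℝ) : Prop :=
  ∃ m : ℝ, 0 < m ∧ ∀ A, MeasurableSet A →
    m * ν.real A ≤ μ.real A ∧ μ.real A ≤ m * (1 + r) * ν.real A

section Comparison

variable {X : Type*} [MeasurableSpace X]

theorem Comparable.tvDist_le {μ ν : Measure X} [IsProbabilityMeasure μ] [IsProbabilityMeasure ν]
    {r : ℝ} (h : Comparable μ ν r) : tvDist μ ν ≤ 2 * ENNReal.ofReal r := by
  obtain ⟨m, hm, h⟩ := h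
  have h1 : m ≤ 1 := by simpa using (h Set.univ MeasurableSet.univ).1
  have h2 : 1 ≤ m * (1 + r) := by simpa using (h Set.univ MeasurableSet.univ).2
  have hr : 0 ≤ r := by
    by_contra! hr
    nlinarith
  refine mul_le_mul_right (iSup₂_le fun B hB => ENNReal.ofReal_le_ofReal (abs_le.2 ?_)) _
  obtain ⟨hl, hu⟩ := h B hB
  have h0 : 0 ≤ ν.real B := measureReal_nonneg
  have hB1 : ν.real B ≤ 1 := measureReal_le_one
  have hmr : m * r ≤ r := by nlinarith
  constructor <;> nlinarith [mul_nonneg hm.le h0, mul_nonneg (mul_nonneg hm.le hr) h0]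

theorem mul_integral_le_of_forall_mul_measureReal_le {μ ν : Measure X} [IsFiniteMeasure μ]
    [IsFiniteMeasure ν] {m : ℝ} (hm : 0 ≤ m)
    (h : ∀ A, MeasurableSet A → m * ν.real A ≤ μ.real A) {f : X → ℝ} (hf : ∀ x, 0 ≤ f x)
    (hi : Integrable f μ) : m * ∫ x, f x ∂ν ≤ ∫ x, f x ∂μ := by
  have hle : ENNReal.ofReal m • ν ≤ μ := by
    refine Measure.le_iff.2 fun A hA => ?_
    rw [Measure.smul_apply, smul_eq_mul, ← ofReal_measureReal (μ := ν),
      ← ofReal_measureReal (μ := μ), ← ENNReal.ofReal_mul hm]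
    exact ENNReal.ofReal_le_ofReal (h A hA)
  have := integral_mono_measure hle (Eventually.of_forall hf) hi
  rwa [integral_smul_measure, ENNReal.toReal_ofReal hm, smul_eq_mul] at this

theorem integral_le_mul_of_forall_measureReal_le_mul {μ ν : Measure X} [IsFiniteMeasure μ]
    [IsFiniteMeasure ν] {m : ℝ} (hm : 0 ≤ m)
    (h : ∀ A, MeasurableSet A → μ.real A ≤ m * ν.real A) {f : X → ℝ} (hf : ∀ x, 0 ≤ f x)
    (hi : Integrable f ν) : ∫ x, f x ∂μ ≤ m * ∫ x, f x ∂ν := by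
  have hle : μ ≤ ENNReal.ofReal m • ν := by
    refine Measure.le_iff.2 fun A hA => ?_
    rw [Measure.smul_apply, smul_eq_mul, ← ofReal_measureReal (μ := ν),
      ← ofReal_measureReal (μ := μ), ← ENNReal.ofReal_mul hm]
    exact ENNReal.ofReal_le_ofReal (h A hA)
  have := integral_mono_measure hle (Eventually.of_forall hf)
    (hi.smul_measure ENNReal.ofReal_ne_top)
  rwa [integral_smul_measure, ENNReal.toReal_ofReal hm, smul_eq_mul] at this

end Comparison

section Model

variable {N : ℕ} {X : Type*} {Y U : Fin N → Type*}
variable [MeasurableSpace X] [∀ i, MeasurableSpace (Y i)] [∀ i, MeasurableSpace (U i)]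
variable {T : Kernel (X × (∀ i, U i)) X} {Q : ∀ i, Kernel X (Y i)}

/-! ### The Bayesian update -/

theorem measurable_kernel_section (T : Kernel (X × (∀ i, U i)) X) (u : ∀ i, U i) :
    Measurable fun x => T (x, u) :=
  T.measurable.comp (measurable_id.prodMk measurable_const)

theorem measurable_likelihood [∀ i, MeasurableSingletonClass (Y i)] (Q : ∀ i, Kernel X (Y i))
    (y : ∀ i, Y i) : Measurable (likelihood Q y) :=
  Finset.measurable_prod _ fun i _ => (Q i).measurable_coe (measurableSet_singleton _)

theorem bayesUpdate_apply [∀ i, MeasurableSingletonClass (Y i)] (Z : Measure X) (y : ∀ i, Y i) (u : ∀ i, U i) {A : Set X}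
    (hA : MeasurableSet A) :
    bayesUpdate T Q Z y u A
      = (∫⁻ x, likelihood Q y x ∂Z)⁻¹ * ∫⁻ x, likelihood Q y x * T (x, u) A ∂Z := by
  have hm := measurable_kernel_section T u
  have hmA : Measurable fun x => T (x, u) A := (Measure.measurable_coe hA).comp hm
  rw [bayesUpdate, Measure.bind_apply hA hm.aemeasurable, lintegral_smul_measure, smul_eq_mul,
    lintegral_withDensity_eq_lintegral_mul _ (measurable_likelihood Q y) hmA]
  rfl

theorem likelihood_le_one (Q : ∀ i, Kernel X (Y i)) [∀ i, IsMarkovKernel (Q i)] (y : ∀ i, Y i)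
    (x : X) : likelihood Q y x ≤ 1 :=
  Finset.prod_le_one' fun _ _ => prob_le_one

theorem likelihood_ne_top (Q : ∀ i, Kernel X (Y i)) [∀ i, IsMarkovKernel (Q i)] (y : ∀ i, Y i)
    (x : X) : likelihood Q y x ≠ ∞ :=
  ((likelihood_le_one Q y x).trans_lt ENNReal.one_lt_top).ne

theorem toReal_likelihood_le_one (Q : ∀ i, Kernel X (Y i)) [∀ i, IsMarkovKernel (Q i)]
    (y : ∀ i, Y i) (x : X) : (likelihood Q y x).toReal ≤ 1 :=
  ENNReal.toReal_le_of_le_ofReal zero_le_one (by simpa using likelihood_le_one Q y x)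

variable [∀ i, MeasurableSingletonClass (Y i)] [∀ i, IsMarkovKernel (Q i)] [IsMarkovKernel T]

theorem integrable_toReal_likelihood (Z : Measure X) [IsFiniteMeasure Z] (y : ∀ i, Y i) :
    Integrable (fun x => (likelihood Q y x).toReal) Z :=
  Integrable.of_bound (measurable_likelihood Q y).ennreal_toReal.aestronglyMeasurable 1
    (Eventually.of_forall fun x => by
      simpa [abs_of_nonneg ENNReal.toReal_nonneg] using toReal_likelihood_le_one Q y x)

theorem integrable_toReal_likelihood_mul (Z : Measure X) [IsFiniteMeasure Z] (y : ∀ i, Y i)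
    (u : ∀ i, U i) {A : Set X} (hA : MeasurableSet A) :
    Integrable (fun x => (likelihood Q y x).toReal * (T (x, u)).real A) Z := by
  refine Integrable.of_bound ((measurable_likelihood Q y).ennreal_toReal.mul
    ((Measure.measurable_coe hA).comp
      (measurable_kernel_section T u)).ennreal_toReal).aestronglyMeasurable 1
    (Eventually.of_forall fun x => ?_)
  rw [Real.norm_of_nonneg (mul_nonneg ENNReal.toReal_nonneg measureReal_nonneg)]
  exact mul_le_one₀ (toReal_likelihood_le_one Q y x) measureReal_nonneg measureReal_le_one

theorem bayesUpdate_real (Z : Measure X) (y : ∀ i, Y i) (u : ∀ i, U i) {A : Set X}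
    (hA : MeasurableSet A) :
    (bayesUpdate T Q Z y u).real A
      = (∫ x, (likelihood Q y x).toReal ∂Z)⁻¹
        * ∫ x, (likelihood Q y x).toReal * (T (x, u)).real A ∂Z := by
  have hm : Measurable fun x => T (x, u) A :=
    (Measure.measurable_coe hA).comp (measurable_kernel_section T u)
  have h2 : ∫ x, (likelihood Q y x).toReal * (T (x, u)).real A ∂Z
      = (∫⁻ x, likelihood Q y x * T (x, u) A ∂Z).toReal := by
    rw [← integral_toReal (f := fun x => likelihood Q y x * T (x, u) A)
      ((measurable_likelihood Q y).mul hm).aemeasurable (Eventually.of_forall fun x =>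
        ENNReal.mul_lt_top (likelihood_ne_top Q y x).lt_top (measure_lt_top _ _))]
    simp [Measure.real, ENNReal.toReal_mul]
  rw [Measure.real, bayesUpdate_apply Z y u hA, ENNReal.toReal_mul, ENNReal.toReal_inv, h2,
    integral_toReal (measurable_likelihood Q y).aemeasurable
      (Eventually.of_forall fun x => (likelihood_ne_top Q y x).lt_top)]

theorem integral_toReal_likelihood_pos (hQ : ∀ y x, likelihood Q y x ≠ 0) (Z : Measure X)
    [IsProbabilityMeasure Z] (y : ∀ i, Y i) : 0 < ∫ x, (likelihood Q y x).toReal ∂Z := by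
  rw [integral_pos_iff_support_of_nonneg (fun _ => ENNReal.toReal_nonneg)
    (integrable_toReal_likelihood Z y)]
  have : Function.support (fun x => (likelihood Q y x).toReal) = Set.univ :=
    Set.eq_univ_of_forall fun x => ENNReal.toReal_ne_zero.2 ⟨hQ y x, likelihood_ne_top Q y x⟩
  simp [this]

theorem isProbabilityMeasure_bayesUpdate (hQ : ∀ y x, likelihood Q y x ≠ 0) (Z : Measure X)
    [IsProbabilityMeasure Z] (y : ∀ i, Y i) (u : ∀ i, U i) :
    IsProbabilityMeasure (bayesUpdate T Q Z y u) := by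
  have h := bayesUpdate_real (T := T) (Q := Q) Z y u MeasurableSet.univ
  simp only [probReal_univ, mul_one] at h
  rw [inv_mul_cancel₀ (integral_toReal_likelihood_pos hQ Z y).ne'] at h
  exact ⟨(ENNReal.toReal_eq_one_iff _).1 h⟩

/-! ### Contraction under a mixing transition kernel -/

/-- A single update turns arbitrary priors into comparable ones: both images are mixtures of the
measures `T (x, u)`, all of which lie between `ε λ` and `ε⁻¹ λ`. -/
theorem comparable_bayesUpdate (hQ : ∀ y x, likelihood Q y x ≠ 0) {lam : Measure X} {ε : ℝ}
    (hε : 0 < ε) (y : ∀ i, Y i) (u : ∀ i, U i)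
    (hT : ∀ x A, MeasurableSet A →
      ε * lam.real A ≤ (T (x, u)).real A ∧ (T (x, u)).real A ≤ ε⁻¹ * lam.real A)
    (μ ν : Measure X) [IsProbabilityMeasure μ] [IsProbabilityMeasure ν] :
    Comparable (bayesUpdate T Q μ y u) (bayesUpdate T Q ν y u) ((ε ^ 4)⁻¹ - 1) := by
  have key : ∀ (Z : Measure X) [IsProbabilityMeasure Z] (A : Set X), MeasurableSet A →
      ε * lam.real A ≤ (bayesUpdate T Q Z y u).real A ∧
        (bayesUpdate T Q Z y u).real A ≤ ε⁻¹ * lam.real A := by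
    intro Z _ A hA
    have hb := integral_toReal_likelihood_pos hQ Z y
    have hi := integrable_toReal_likelihood (Q := Q) Z y
    have hi' := integrable_toReal_likelihood_mul (T := T) (Q := Q) Z y u hA
    rw [bayesUpdate_real Z y u hA]
    constructor
    · rw [le_inv_mul_iff₀ hb, ← integral_mul_const]
      exact integral_mono (hi.mul_const _) hi' fun x =>
        mul_le_mul_of_nonneg_left (hT x A hA).1 ENNReal.toReal_nonneg
    · rw [inv_mul_le_iff₀ hb, ← integral_mul_const]
      exact integral_mono hi' (hi.mul_const _) fun x =>
        mul_le_mul_of_nonneg_left (hT x A hA).2 ENNReal.toReal_nonneg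
  refine ⟨ε ^ 2, by positivity, fun A hA => ?_⟩
  obtain ⟨hμl, hμu⟩ := key μ A hA
  obtain ⟨hνl, hνu⟩ := key ν A hA
  constructor
  · calc ε ^ 2 * _ ≤ ε ^ 2 * (ε⁻¹ * lam.real A) := by gcongr
      _ = ε * lam.real A := by field_simp
      _ ≤ _ := hμl
  · calc _ ≤ ε⁻¹ * lam.real A := hμu
      _ = ε ^ 2 * (1 + ((ε ^ 4)⁻¹ - 1)) * (ε * lam.real A) := by field_simp; ring
      _ ≤ _ := by
        have : 0 ≤ ε ^ 2 * (1 + ((ε ^ 4)⁻¹ - 1)) := by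
          rw [add_sub_cancel]; positivity
        gcongr

/-- An update shrinks the slack by the factor `1 - ε ^ 2`. Testing `μ - m ν ≥ 0` and
`m (1 + r) ν - μ ≥ 0` against `Q (T - ε λ) ≥ 0` instead of `Q T ≥ 0` gains a multiple of `λ`, which
in turn dominates a multiple of the updated `ν`. -/
theorem Comparable.update (hQ : ∀ y x, likelihood Q y x ≠ 0) {lam : Measure X} {ε : ℝ}
    (hε : 0 < ε) (hε1 : ε ≤ 1) (y : ∀ i, Y i) (u : ∀ i, U i)
    (hT : ∀ x A, MeasurableSet A →
      ε * lam.real A ≤ (T (x, u)).real A ∧ (T (x, u)).real A ≤ ε⁻¹ * lam.real A)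
    {μ ν : Measure X} [IsProbabilityMeasure μ] [IsProbabilityMeasure ν] {r : ℝ} (hr : 0 ≤ r)
    (h : Comparable μ ν r) :
    Comparable (bayesUpdate T Q μ y u) (bayesUpdate T Q ν y u) ((1 - ε ^ 2) * r) := by
  obtain ⟨m, hm, h⟩ := h
  have ha := integral_toReal_likelihood_pos hQ μ y
  have hb := integral_toReal_likelihood_pos hQ ν y
  have hia := integrable_toReal_likelihood (Q := Q) μ y
  have hib := integrable_toReal_likelihood (Q := Q) ν y
  have hM : 0 ≤ m * (1 + r) := by positivity
  have hab := mul_integral_le_of_forall_mul_measureReal_le hm.le (fun A hA => (h A hA).1)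
    (fun _ => ENNReal.toReal_nonneg) hia
  have hba := integral_le_mul_of_forall_measureReal_le_mul hM (fun A hA => (h A hA).2)
    (fun _ => ENNReal.toReal_nonneg) hib
  have hε2 : ε ^ 2 ≤ 1 := pow_le_one₀ hε.le hε1
  have hstep : ∀ A, MeasurableSet A →
      (m * (∫ x, (likelihood Q y x).toReal ∂ν) + ε ^ 2 * ((∫ x, (likelihood Q y x).toReal ∂μ)
          - m * ∫ x, (likelihood Q y x).toReal ∂ν)) * (bayesUpdate T Q ν y u).real A
        ≤ (∫ x, (likelihood Q y x).toReal ∂μ) * (bayesUpdate T Q μ y u).real A ∧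
      (∫ x, (likelihood Q y x).toReal ∂μ) * (bayesUpdate T Q μ y u).real A
        ≤ (m * (1 + r) * (∫ x, (likelihood Q y x).toReal ∂ν)
          - ε ^ 2 * (m * (1 + r) * (∫ x, (likelihood Q y x).toReal ∂ν)
            - ∫ x, (likelihood Q y x).toReal ∂μ)) * (bayesUpdate T Q ν y u).real A := by
    intro A hA
    have hja := integrable_toReal_likelihood_mul (T := T) (Q := Q) μ y u hA
    have hjb := integrable_toReal_likelihood_mul (T := T) (Q := Q) ν y u hA
    have hf : ∀ x, 0 ≤ (likelihood Q y x).toReal * (T (x, u)).real A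
        - (likelihood Q y x).toReal * (ε * lam.real A) := fun x =>
      sub_nonneg.2 (mul_le_mul_of_nonneg_left (hT x A hA).1 ENNReal.toReal_nonneg)
    have e1 := mul_integral_le_of_forall_mul_measureReal_le hm.le (fun A hA => (h A hA).1)
      hf (hja.sub (hia.mul_const _))
    have e2 := integral_le_mul_of_forall_measureReal_le_mul hM (fun A hA => (h A hA).2)
      hf (hjb.sub (hib.mul_const _))
    have e3 : ∫ x, (likelihood Q y x).toReal * (T (x, u)).real A ∂ν
        ≤ (∫ x, (likelihood Q y x).toReal ∂ν) * (ε⁻¹ * lam.real A) := by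
      rw [← integral_mul_const]
      exact integral_mono hjb (hib.mul_const _) fun x =>
        mul_le_mul_of_nonneg_left (hT x A hA).2 ENNReal.toReal_nonneg
    rw [integral_sub hja (hia.mul_const _), integral_sub hjb (hib.mul_const _),
      integral_mul_const, integral_mul_const] at e1 e2
    rw [bayesUpdate_real μ y u hA, bayesUpdate_real ν y u hA, mul_inv_cancel_left₀ ha.ne']
    set a := ∫ x, (likelihood Q y x).toReal ∂μ
    set b := ∫ x, (likelihood Q y x).toReal ∂ν
    set p := ∫ x, (likelihood Q y x).toReal * (T (x, u)).real A ∂μ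
    set n := ∫ x, (likelihood Q y x).toReal * (T (x, u)).real A ∂ν
    have e4 : ε ^ 2 * (b⁻¹ * n) ≤ ε * lam.real A := by
      calc ε ^ 2 * (b⁻¹ * n) ≤ ε ^ 2 * (b⁻¹ * (b * (ε⁻¹ * lam.real A))) := by gcongr
        _ = ε * lam.real A := by field_simp
    have hn : n = b * (b⁻¹ * n) := (mul_inv_cancel_left₀ hb.ne' n).symm
    generalize b⁻¹ * n = c at *
    rw [hn] at e1 e2
    have g1 := mul_le_mul_of_nonneg_left e4 (sub_nonneg.2 hab)
    have g2 := mul_le_mul_of_nonneg_left e4 (sub_nonneg.2 hba)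
    constructor <;> linarith
  -- normalizing divides both bounds by `∫ Q dμ`, which leaves their ratio unchanged
  generalize (∫ x, (likelihood Q y x).toReal ∂μ) = a at *
  generalize (∫ x, (likelihood Q y x).toReal ∂ν) = b at *
  have hmb : 0 < m * b := mul_pos hm hb
  have hm' : 0 < m * b + ε ^ 2 * (a - m * b) :=
    add_pos_of_pos_of_nonneg hmb (mul_nonneg (sq_nonneg ε) (sub_nonneg.2 hab))
  refine ⟨(m * b + ε ^ 2 * (a - m * b)) / a, div_pos hm' ha, fun A hA => ?_⟩
  obtain ⟨hl, hu⟩ := hstep A hA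
  constructor
  · rwa [div_mul_eq_mul_div, div_le_iff₀' ha]
  · rw [div_mul_eq_mul_div, div_mul_eq_mul_div, le_div_iff₀' ha]
    refine hu.trans (mul_le_mul_of_nonneg_right ?_ measureReal_nonneg)
    have := mul_nonneg (mul_nonneg (sub_nonneg.2 hε2) hr)
      (mul_nonneg (sq_nonneg ε) (sub_nonneg.2 hab))
    linarith

theorem isProbabilityMeasure_updateAlong (hQ : ∀ y x, likelihood Q y x ≠ 0) (Z : Measure X)
    [IsProbabilityMeasure Z] {n : ℕ} (w : Record Y U n) :
    IsProbabilityMeasure (updateAlong T Q Z w) := by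
  induction n with
  | zero => simpa [updateAlong]
  | succ n ih =>
    have := ih fun j => w j.castSucc
    exact isProbabilityMeasure_bayesUpdate hQ _ _ _

theorem comparable_updateAlong (hQ : ∀ y x, likelihood Q y x ≠ 0) {lam : Measure X} {ε : ℝ}
    (hε : 0 < ε) (hε1 : ε ≤ 1)
    (hT : ∀ u x A, MeasurableSet A →
      ε * lam.real A ≤ (T (x, u)).real A ∧ (T (x, u)).real A ≤ ε⁻¹ * lam.real A)
    (μ ν : Measure X) [IsProbabilityMeasure μ] [IsProbabilityMeasure ν] {n : ℕ}
    (w : Record Y U (n + 1)) :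
    Comparable (updateAlong T Q μ w) (updateAlong T Q ν w)
      ((1 - ε ^ 2) ^ n * ((ε ^ 4)⁻¹ - 1)) := by
  induction n with
  | zero =>
    simpa [updateAlong] using comparable_bayesUpdate hQ hε _ _ (hT _) μ ν
  | succ n ih =>
    have hμ := isProbabilityMeasure_updateAlong (T := T) hQ μ fun j => w j.castSucc
    have hν := isProbabilityMeasure_updateAlong (T := T) hQ ν fun j => w j.castSucc
    rw [pow_succ', mul_assoc]
    refine (ih fun j => w j.castSucc).update hQ hε hε1 _ _ (hT _) (mul_nonneg ?_ ?_)
    · exact pow_nonneg (sub_nonneg.2 (pow_le_one₀ hε.le hε1)) _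
    · exact sub_nonneg.2 ((one_le_inv₀ (by positivity)).2 (pow_le_one₀ hε.le hε1))

/-! ### The law of the controlled system and the predictor -/

variable [∀ i, Finite (Y i)] [∀ i, Finite (U i)] [∀ i, MeasurableSingletonClass (U i)]

instance isMarkovKernel_obsKernel : IsMarkovKernel (obsKernel Q) :=
  ⟨fun x => inferInstanceAs (IsProbabilityMeasure (Measure.pi fun i => Q i x))⟩

theorem measurable_law_step {K : ℕ} (γ : Policy Y U K) (t : ℕ) :
    Measurable fun z : (X × Record Y U t) × ((∀ i, Y i) × X) =>
      ((z.2.2, Fin.snoc (α := fun _ => (∀ i, Y i) × (∀ i, U i)) z.1.2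
        (z.2.1, γ.act t z.1.2 z.2.1)) : X × Record Y U (t + 1)) :=
  (measurable_snd.comp measurable_snd).prodMk
    ((measurable_of_finite fun p : Record Y U t × (∀ i, Y i) =>
      (Fin.snoc (α := fun _ => (∀ i, Y i) × (∀ i, U i)) p.1
        (p.2, γ.act t p.1 p.2) : Record Y U (t + 1))).comp
      ((measurable_snd.comp measurable_fst).prodMk (measurable_fst.comp measurable_snd)))

theorem isProbabilityMeasure_law {K : ℕ} (π : Measure X) [IsProbabilityMeasure π]
    (γ : Policy Y U K) (t : ℕ) : IsProbabilityMeasure (law T Q π γ t) := by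
  induction t with
  | zero =>
    exact Measure.isProbabilityMeasure_map (measurable_id.prodMk measurable_const).aemeasurable
  | succ t ih =>
    exact Measure.isProbabilityMeasure_map (measurable_law_step γ t).aemeasurable

/-- Almost every record has, cut off at time `s`, positive probability. -/
theorem ae_law_preimage_ne_zero {K : ℕ} (π : Measure X) [IsProbabilityMeasure π]
    (γ : Policy Y U K) (s k : ℕ) :
    ∀ᵐ z ∂(law T Q π γ (s + k)),
      law T Q π γ s (Prod.snd ⁻¹' {fun j : Fin s => z.2 (j.castAdd k)}) ≠ 0 := by
  induction k with
  | zero =>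
    have : ∀ᵐ z ∂(law T Q π γ s), ∀ h : Record Y U s,
        law T Q π γ s (Prod.snd ⁻¹' {h}) = 0 → z.2 ≠ h := by
      refine ae_all_iff.2 fun h => ?_
      by_cases h0 : law T Q π γ s (Prod.snd ⁻¹' {h}) = 0
      · filter_upwards [measure_eq_zero_iff_ae_notMem.1 h0] with z hz _ using hz
      · exact Eventually.of_forall fun z hz => absurd hz h0
    filter_upwards [this] with z hz h0 using hz _ h0 rfl
  | succ k ih =>
    have := isProbabilityMeasure_law (T := T) (Q := Q) π γ (s + k)
    refine (ae_map_iff (measurable_law_step γ (s + k)).aemeasurable ?_).2 ?_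
    · exact measurable_snd (Set.toFinite {h : Record Y U (s + k + 1) |
        law T Q π γ s (Prod.snd ⁻¹' {fun j : Fin s => h (j.castAdd (k + 1))}) ≠ 0}).measurableSet
    · -- a property of the past at time `s + k` is not affected by the transition that follows
      have hmeas : MeasurableSet {z : X × Record Y U (s + k) |
          law T Q π γ s (Prod.snd ⁻¹' {fun j : Fin s => z.2 (j.castAdd k)}) ≠ 0} :=
        measurable_snd (Set.toFinite {h : Record Y U (s + k) |
          law T Q π γ s (Prod.snd ⁻¹' {fun j : Fin s => h (j.castAdd k)}) ≠ 0}).measurableSet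
      have hcut : ∀ (r : Record Y U (s + k)) (v : (∀ i, Y i) × (∀ i, U i)),
          (fun j : Fin s => (Fin.snoc (α := fun _ => (∀ i, Y i) × (∀ i, U i)) r v :
            Record Y U (s + k + 1)) (j.castAdd (k + 1))) = fun j => r (j.castAdd k) :=
        fun r v => funext fun j =>
          Fin.snoc_castSucc (α := fun _ => (∀ i, Y i) × (∀ i, U i)) v r (j.castAdd k)
      filter_upwards [Measure.ae_compProd_of_ae_fst _ hmeas ih] with z hz
      rwa [hcut]

theorem isProbabilityMeasure_predictor {K : ℕ} (π : Measure X) [IsProbabilityMeasure π]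
    (γ : Policy Y U K) (t : ℕ) (h : Record Y U t)
    (h0 : law T Q π γ t (Prod.snd ⁻¹' {h}) ≠ 0) :
    IsProbabilityMeasure (predictor T Q π γ t h) := by
  have := isProbabilityMeasure_law (T := T) (Q := Q) π γ t
  have := cond_isProbabilityMeasure h0
  exact Measure.isProbabilityMeasure_map measurable_fst.aemeasurable

/-! ### The predictor error -/

theorem predictorError_le (hQ : ∀ y x, likelihood Q y x ≠ 0) {lam : Measure X} {ε : ℝ}
    (hε : 0 < ε) (hε1 : ε ≤ 1)
    (hT : ∀ u x A, MeasurableSet A →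
      ε * lam.real A ≤ (T (x, u)).real A ∧ (T (x, u)).real A ≤ ε⁻¹ * lam.real A)
    (π πstar : Measure X) [IsProbabilityMeasure π] [IsProbabilityMeasure πstar]
    {K q M n : ℕ} (hn : M * K = n + 1) :
    predictorError K T Q π πstar q M
      ≤ 2 * ENNReal.ofReal ((1 - ε ^ 2) ^ n * ((ε ^ 4)⁻¹ - 1)) := by
  refine iSup_le fun γ => ?_
  have := isProbabilityMeasure_law (T := T) (Q := Q) π γ ((q + M) * K)
  -- `(q + M) * K` and `q * K + M * K` agree only propositionally, and records are indexed by them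
  have hae : ∀ t, (ht : q * K + M * K = t) → ∀ᵐ z ∂(law T Q π γ t),
      law T Q π γ (q * K) (Prod.snd ⁻¹' {fun j : Fin (q * K) =>
        z.2 ⟨j, j.2.trans_le (by omega)⟩}) ≠ 0 := by
    rintro _ rfl
    exact ae_law_preimage_ne_zero π γ (q * K) (M * K)
  calc _ ≤ ∫⁻ _, 2 * ENNReal.ofReal ((1 - ε ^ 2) ^ n * ((ε ^ 4)⁻¹ - 1))
        ∂(law T Q π γ ((q + M) * K)) := by
        refine lintegral_mono_ae ?_
        filter_upwards [hae _ (Nat.add_mul q M K).symm] with z hz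
        have hp := isProbabilityMeasure_predictor π γ (q * K) _ hz
        have hwin : ∀ (l : ℕ) (w : Record Y U l), l = n + 1 →
            tvDist (updateAlong T Q (predictor T Q π γ (q * K) fun j : Fin (q * K) =>
              z.2 ⟨j, j.2.trans_le (Nat.mul_le_mul_right K (Nat.le_add_right q M))⟩) w)
              (updateAlong T Q πstar w)
              ≤ 2 * ENNReal.ofReal ((1 - ε ^ 2) ^ n * ((ε ^ 4)⁻¹ - 1)) := by
          rintro l w rfl
          have h1 := isProbabilityMeasure_updateAlong (T := T) hQ (predictor T Q π γ (q * K)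
            fun j : Fin (q * K) =>
              z.2 ⟨j, j.2.trans_le (Nat.mul_le_mul_right K (Nat.le_add_right q M))⟩) w
          have h2 := isProbabilityMeasure_updateAlong (T := T) hQ πstar w
          exact (comparable_updateAlong hQ hε hε1 hT _ _ w).tvDist_le
        exact hwin _ _ hn
    _ = _ := by simp

end Model

end DecentralizedControl

theorem mainTheorem5 {N : ℕ} {X : Type*} [MeasurableSpace X] [StandardBorelSpace X]
    {Y U : Fin N → Type*}
    [∀ i, MeasurableSpace (Y i)] [∀ i, MeasurableSingletonClass (Y i)] [∀ i, Finite (Y i)]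
    [∀ i, MeasurableSpace (U i)] [∀ i, MeasurableSingletonClass (U i)] [∀ i, Finite (U i)]
    (K : ℕ) (hK : 1 ≤ K)
    (T : Kernel (X × (∀ i, U i)) X) [IsMarkovKernel T]
    (Q : ∀ i, Kernel X (Y i)) [∀ i, IsMarkovKernel (Q i)]
    (hQ : ∃ ε : ℝ, 0 < ε ∧
      ∀ (x : X) (y : ∀ i, Y i), ENNReal.ofReal ε ≤ DecentralizedControl.likelihood Q y x)
    (hT : ∃ (lam : Measure X) (ε : (∀ i, U i) → ℝ), (∀ u, 0 < ε u) ∧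
      ∀ (u : ∀ i, U i) (x : X) (A : Set X), MeasurableSet A →
        ENNReal.ofReal (ε u) * lam A ≤ T (x, u) A ∧
        T (x, u) A ≤ ENNReal.ofReal (1 / ε u) * lam A)
    (π πstar : Measure X) [IsProbabilityMeasure π] [IsProbabilityMeasure πstar] (q : ℕ) :
    Tendsto (fun M : ℕ => DecentralizedControl.predictorError K T Q π πstar q M)
      atTop (𝓝 0) := by
  obtain ⟨δ, hδ, hQδ⟩ := hQ
  have hQ0 : ∀ y x, DecentralizedControl.likelihood Q y x ≠ 0 := fun y x =>
    ((ENNReal.ofReal_pos.2 hδ).trans_le (hQδ x y)).ne'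
  obtain ⟨lam, e, he, hT⟩ := hT
  -- a single mixing constant, at most `1`, that serves all the finitely many actions
  obtain ⟨ε, hε, hε1, hεe⟩ : ∃ ε : ℝ, 0 < ε ∧ ε ≤ 1 ∧ ∀ u, ε ≤ e u := by
    rcases isEmpty_or_nonempty (∀ i, U i) with hU | hU
    · exact ⟨1, one_pos, le_rfl, fun u => (hU.false u).elim⟩
    · obtain ⟨u₀, hu₀⟩ := Finite.exists_min e
      exact ⟨min (e u₀) 1, lt_min (he _) one_pos, min_le_right _ _,
        fun u => (min_le_left _ _).trans (hu₀ u)⟩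
  have hTε : ∀ u x A, MeasurableSet A →
      ε * lam.real A ≤ (T (x, u)).real A ∧ (T (x, u)).real A ≤ ε⁻¹ * lam.real A := by
    intro u x A hA
    obtain ⟨hl, hu⟩ := hT u x A hA
    have hfin : lam A ≠ ∞ := by
      intro htop
      rw [htop, ENNReal.mul_top (ENNReal.ofReal_pos.2 (he u)).ne'] at hl
      exact measure_ne_top _ _ (top_le_iff.1 hl)
    have hl' : e u * lam.real A ≤ (T (x, u)).real A := by
      have := ENNReal.toReal_mono (measure_ne_top _ _) hl
      rwa [ENNReal.toReal_mul, ENNReal.toReal_ofReal (he u).le] at this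
    have hu' : (T (x, u)).real A ≤ 1 / e u * lam.real A := by
      have := ENNReal.toReal_mono (ENNReal.mul_ne_top ENNReal.ofReal_ne_top hfin) hu
      rwa [ENNReal.toReal_mul, ENNReal.toReal_ofReal (one_div_pos.2 (he u)).le] at this
    refine ⟨(mul_le_mul_of_nonneg_right (hεe u) measureReal_nonneg).trans hl',
      hu'.trans (mul_le_mul_of_nonneg_right ?_ measureReal_nonneg)⟩
    rw [one_div]
    exact inv_anti₀ hε (hεe u)
  have hbound : Tendsto (fun M : ℕ =>
      2 * ENNReal.ofReal ((1 - ε ^ 2) ^ (M * K - 1) * ((ε ^ 4)⁻¹ - 1))) atTop (𝓝 0) := by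
    have hexp : Tendsto (fun M : ℕ => M * K - 1) atTop atTop :=
      (tendsto_sub_atTop_nat 1).comp (tendsto_id.atTop_mul_const' hK)
    have hpow := ((tendsto_pow_atTop_nhds_zero_of_lt_one
      (sub_nonneg.2 (pow_le_one₀ hε.le hε1)) (sub_lt_self 1 (pow_pos hε 2))).comp
        hexp).mul_const ((ε ^ 4)⁻¹ - 1)
    have := ENNReal.Tendsto.const_mul (a := 2) (ENNReal.tendsto_ofReal hpow)
      (Or.inr ENNReal.ofNat_ne_top)
    simpa using this
  refine tendsto_of_tendsto_of_tendsto_of_le_of_le' tendsto_const_nhds hbound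
    (Eventually.of_forall fun _ => bot_le) ?_
  filter_upwards [eventually_ge_atTop 1] with M hM
  exact DecentralizedControl.predictorError_le hQ0 hε hε1 hTε π πstar
    (Nat.sub_add_cancel (Nat.mul_pos hM hK)).symm
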